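/- Let $d,n\ge 1$, let $K\subset\mathbb{R}^n$ be compact, and let $\mathcal{M}_1(K)$ be the set of Borel probability measures on $K$, equipped with the weak topology (from duality with the continuous functions on $K$); $\mathcal{M}_1(K)^d$ carries the product topology. For finite positive Borel measures $\mu,\nu$ on $K$ let $$I(\mu,\nu)=\iint\log\frac1{|x-y|}\,d\mu(x)\,d\nu(y)\in(-\infty,+\infty],\qquad I(\mu)=I(\mu,\mu),$$ where $|\cdot|$ is the Euclidean norm and $\log\frac1{0}=+\infty$. Assume that $K$ has positive capacity, i.e. that $I(\mu)<+\infty$ for some nonzero finite positive Borel measure $\mu$ on $K$. Let $C=(c_{ij})$ be a real symmetric positive definite $d\times d$ matrix, and put $$J_0(\mu_1,\ldots,\mu_d)=\begin{cases}\displaystyle\sum_{1\le i,j\le d}c_{ij}\,I(\mu_i,\mu_j)&\text{if } I(\mu_i)<+\infty\text{ for all } i,\\ +\infty&\text{otherwise.}\end{cases}$$ Then $J_0$ takes values in $(-\infty,+\infty]$ on $\mathcal{M}_1(K)^d$, it is lower semi-continuous on $\mathcal{M}_1(K)^d$, and the set $\{\boldsymbol\mu\in\mathcal{M}_1(K)^d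 : J_0(\boldsymbol\mu)<+\infty\}$ is convex and $J_0$ is strictly convex on it. -/

import Mathlib

open MeasureTheory
open scoped NNReal ENNReal

namespace LogEnergy

noncomputable section

/-- The logarithmic kernel `log (1 / |x - y|)` with values in `(-∞, +∞]`; it is `+∞` for `x = y`. -/
def logKernel {X : Type*} [PseudoMetricSpace X] (x y : X) : EReal :=
  ENNReal.log (edist x y)⁻¹

theorem logKernel_of_dist_pos {X : Type*} [PseudoMetricSpace X] {x y : X} (h : 0 < dist x y) :
    logKernel x y = ((Real.log (1 / dist x y) : ℝ) : EReal) := by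
  rw [logKernel, edist_dist, ← ENNReal.ofReal_inv_of_pos h,
    ENNReal.log_ofReal_of_pos (inv_pos.mpr h), one_div]

theorem logKernel_self {X : Type*} [PseudoMetricSpace X] (x : X) : logKernel x x = ⊤ := by
  simp [logKernel]

/-- The mutual logarithmic energy `I(μ, ν) = ∬ log (1 / |x - y|) dμ(x) dν(y)`: the integral of the
positive part of the kernel minus the integral of its negative part. For finite measures on a
bounded space the second integral is finite, so that `I(μ, ν)` lies in `(-∞, +∞]`. -/
def mutualEnergy {X : Type*} [PseudoMetricSpace X] [MeasurableSpace X] (μ ν : Measure X) : EReal :=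
  ((∫⁻ p, (logKernel p.1 p.2).toENNReal ∂(μ.prod ν) : ℝ≥0∞) : EReal)
    - ((∫⁻ p, (-logKernel p.1 p.2).toENNReal ∂(μ.prod ν) : ℝ≥0∞) : EReal)

/-- The logarithmic energy `I(μ) = I(μ, μ)`. -/
def energy {X : Type*} [PseudoMetricSpace X] [MeasurableSpace X] (μ : Measure X) : EReal :=
  mutualEnergy μ μ

/-- A set has positive capacity if it carries a nonzero finite Borel measure of finite
logarithmic energy. -/
def HasPositiveCapacity {X : Type*} [PseudoMetricSpace X] [MeasurableSpace X] (S : Set X) : Prop :=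
  ∃ μ : Measure S, IsFiniteMeasure μ ∧ μ ≠ 0 ∧ energy μ ≠ ⊤ ∧ energy μ ≠ ⊥

open Classical in
/-- The functional `J₀(μ₁, …, μ_d)`: it is `∑ c_ij I(μ_i, μ_j)` if all `I(μ_i) < +∞`, and `+∞`
otherwise. -/
def J₀ {X : Type*} [PseudoMetricSpace X] [MeasurableSpace X] {d : ℕ}
    (C : Matrix (Fin d) (Fin d) ℝ) (μ : Fin d → Measure X) : EReal :=
  if ∀ i, energy (μ i) < ⊤ then ∑ i, ∑ j, (C i j : EReal) * mutualEnergy (μ i) (μ j) else ⊤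

end

end LogEnergy

namespace LogEnergy

/-! Inverse stereographic projection turns the logarithmic kernel into a power series with positive
coefficients. It sends `x` to a unit vector `τ x`, with `p = ⟪τ x, τ y⟫ ≥ 0` and `dist x y ^ 2 = (1
+ ‖x‖ ^ 2) * (1 + ‖y‖ ^ 2) * (1 - p)`. Hence `log (1 / dist x y) = ∑ p ^ (m + 1) / (2 * (m + 1)) - b
x - b y` with `b = log (1 + ‖x‖ ^ 2) / 2`; on the diagonal both sides are `⊤`.

Expanding `p ^ m` over words in the coordinates of `τ` separates the variables, so its integral
against `μ.prod ν` is an inner product of moment vectors (`integral_prod_pow`). Thus `J₀` is a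
positively weighted series of values of the quadratic form of `C` at moments, minus a weakly
continuous affine term (`J₀_eq`).

The terms of the series are nonnegative and weakly continuous, so the sum is lower semicontinuous
and never `⊥`. Each term is convex, with an explicit defect. If all defects vanish, all moments
agree, and the measures coincide by Stone–Weierstrass (`measure_eq_of_moment_eq`). -/

/-! ### Positive definite quadratic forms -/

/-- The quadratic form of a real square matrix. -/
def quadForm {d : ℕ} (C : Matrix (Fin d) (Fin d) ℝ) (x : Fin d → ℝ) : ℝ :=
  ∑ i, ∑ j, C i j * (x i * x j)

theorem quadForm_pos {d : ℕ} {C : Matrix (Fin d) (Fin d) ℝ} (hC : C.PosDef) {x : Fin d → ℝ}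
    (hx : x ≠ 0) : 0 < quadForm C x := by
  have h := hC.dotProduct_mulVec_pos hx
  simp only [dotProduct, Matrix.mulVec, Pi.star_apply, star_trivial, Finset.mul_sum] at h
  refine h.trans_eq (Finset.sum_congr rfl fun i _ => Finset.sum_congr rfl fun j _ => ?_)
  ring

theorem quadForm_nonneg {d : ℕ} {C : Matrix (Fin d) (Fin d) ℝ} (hC : C.PosDef) (x : Fin d → ℝ) :
    0 ≤ quadForm C x := by
  by_cases hx : x = 0
  · simp [quadForm, hx]
  · exact (quadForm_pos hC hx).le

theorem continuous_quadForm {d : ℕ} (C : Matrix (Fin d) (Fin d) ℝ) :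
    Continuous (quadForm C) := by
  unfold quadForm
  fun_prop

theorem quadForm_smul {d : ℕ} (C : Matrix (Fin d) (Fin d) ℝ) (c : ℝ) (x : Fin d → ℝ) :
    quadForm C (c • x) = c ^ 2 * quadForm C x := by
  simp only [quadForm, Pi.smul_apply, smul_eq_mul, Finset.mul_sum]
  refine Finset.sum_congr rfl fun i _ => Finset.sum_congr rfl fun j _ => ?_
  ring

/-- The term `a * b * quadForm C (x - y)` is the exact convexity defect; its positivity is the
source of strict convexity. -/
theorem quadForm_convexComb {d : ℕ} (C : Matrix (Fin d) (Fin d) ℝ) {a b : ℝ} (hab : a + b = 1)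
    (x y : Fin d → ℝ) :
    quadForm C (a • x + b • y) + a * b * quadForm C (x - y)
      = a * quadForm C x + b * quadForm C y := by
  obtain rfl : b = 1 - a := by linarith
  simp only [quadForm, Pi.smul_apply, Pi.add_apply, Pi.sub_apply, smul_eq_mul, Finset.mul_sum,
    ← Finset.sum_add_distrib]
  refine Finset.sum_congr rfl fun i _ => Finset.sum_congr rfl fun j _ => ?_
  ring

/-- Compactness of the unit sphere and homogeneity. This coercivity lets finiteness of the series
for `J₀` control each individual energy. -/
theorem exists_pos_mul_sq_le_quadForm {d : ℕ} {C : Matrix (Fin d) (Fin d) ℝ} (hC : C.PosDef) :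
    ∃ r : ℝ, 0 < r ∧ ∀ x i, r * x i ^ 2 ≤ quadForm C x := by
  obtain ⟨r, hr, h⟩ := (isCompact_sphere (0 : Fin d → ℝ) 1).exists_forall_le'
    (continuous_quadForm C).continuousOn (a := 0) fun x hx => quadForm_pos hC fun h0 => by
      simp [h0] at hx
  refine ⟨r, hr, fun x i => ?_⟩
  by_cases hx : x = 0
  · simp [hx, quadForm]
  have hn : 0 < ‖x‖ := norm_pos_iff.mpr hx
  have h1 := h (‖x‖⁻¹ • x) (by simp [norm_smul, hn.ne'])
  rw [quadForm_smul, inv_pow, ← div_eq_inv_mul, le_div_iff₀ (by positivity)] at h1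
  refine le_trans ?_ h1
  gcongr r * ?_
  rw [← sq_abs]
  gcongr
  exact norm_le_pi_norm x i

/-! ### Moments of measures and powers of an inner product kernel -/

section Moments

variable {X ι : Type*} [TopologicalSpace X] [Fintype ι]

/-- The product of the functions `τ (α 0), …, τ (α (m - 1))`. -/
noncomputable def wordProd (τ : ι → C(X, ℝ)) {m : ℕ} (α : Fin m → ι) : C(X, ℝ) :=
  ∏ k, τ (α k)

theorem sum_wordProd_mul_wordProd (τ : ι → C(X, ℝ)) (m : ℕ) (x y : X) :
    ∑ α : Fin m → ι, wordProd τ α x * wordProd τ α y = (∑ i, τ i x * τ i y) ^ m := by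
  classical
  rw [Finset.sum_pow', Fintype.piFinset_univ]
  refine Finset.sum_congr rfl fun α _ => ?_
  simp [wordProd, Finset.prod_mul_distrib]

variable [MeasurableSpace X]

/-- The integral of the product of functions indexed by a word. -/
noncomputable def moment (τ : ι → C(X, ℝ)) {m : ℕ} (α : Fin m → ι) (μ : Measure X) : ℝ :=
  ∫ x, wordProd τ α x ∂μ

/-- The inner product of the moments of order `m` of two measures. -/
noncomputable def momentInner (τ : ι → C(X, ℝ)) (m : ℕ) (μ ν : Measure X) : ℝ :=
  ∑ α : Fin m → ι, moment τ α μ * moment τ α ν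

theorem two_mul_momentInner_le (τ : ι → C(X, ℝ)) (m : ℕ) (μ ν : Measure X) :
    2 * momentInner τ m μ ν ≤ momentInner τ m μ μ + momentInner τ m ν ν := by
  simp only [momentInner, Finset.mul_sum, ← Finset.sum_add_distrib]
  refine Finset.sum_le_sum fun α _ => ?_
  nlinarith [sq_nonneg (moment τ α μ - moment τ α ν)]

variable [CompactSpace X] [BorelSpace X]

theorem integrable_continuousMap (f : C(X, ℝ)) (μ : Measure X) [IsFiniteMeasure μ] :
    Integrable f μ :=
  (BoundedContinuousFunction.mkOfCompact f).integrable μ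

theorem integral_smul_add_smul (f : C(X, ℝ)) (a b : ℝ≥0) (μ ν : Measure X) [IsFiniteMeasure μ]
    [IsFiniteMeasure ν] :
    ∫ x, f x ∂(a • μ + b • ν) = a * ∫ x, f x ∂μ + b * ∫ x, f x ∂ν := by
  rw [integral_add_measure (integrable_continuousMap f _) (integrable_continuousMap f _),
    integral_smul_nnreal_measure, integral_smul_nnreal_measure]
  rfl

theorem continuous_integral_continuousMap (f : C(X, ℝ)) :
    Continuous fun μ : ProbabilityMeasure X => ∫ x, f x ∂(μ : Measure X) :=
  ProbabilityMeasure.continuous_integral_boundedContinuousFunction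
    (BoundedContinuousFunction.mkOfCompact f)

end Moments

section Prod

variable {X ι : Type*} [TopologicalSpace X] [CompactSpace X] [SecondCountableTopology X]
  [MeasurableSpace X] [BorelSpace X] [Fintype ι]

theorem integral_prod_pow (τ : ι → C(X, ℝ)) (m : ℕ) (μ ν : Measure X) [IsFiniteMeasure μ]
    [IsFiniteMeasure ν] :
    ∫ z, (∑ i, τ i z.1 * τ i z.2) ^ m ∂(μ.prod ν) = momentInner τ m μ ν := by
  simp_rw [← sum_wordProd_mul_wordProd]
  rw [integral_finsetSum _ fun α _ =>
    (integrable_continuousMap (wordProd τ α) μ).mul_prod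
      (integrable_continuousMap (wordProd τ α) ν)]
  exact Finset.sum_congr rfl fun α _ => integral_prod_mul _ _

/-- Nonnegativity of the inner product makes every term nonnegative, so sum and integral commute
even when the result is infinite. -/
theorem lintegral_prod_tsum_pow (τ : ι → C(X, ℝ)) (hτ : ∀ x y, 0 ≤ ∑ i, τ i x * τ i y)
    {w : ℕ → ℝ} (hw : ∀ m, 0 ≤ w m) (μ ν : Measure X) [IsFiniteMeasure μ] [IsFiniteMeasure ν] :
    ∫⁻ z, ∑' m, ENNReal.ofReal (w m * (∑ i, τ i z.1 * τ i z.2) ^ (m + 1)) ∂(μ.prod ν)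
      = ∑' m, ENNReal.ofReal (w m * momentInner τ (m + 1) μ ν) := by
  have hc : ∀ m, Continuous fun z : X × X => w m * (∑ i, τ i z.1 * τ i z.2) ^ (m + 1) := by
    intro m
    fun_prop
  rw [lintegral_tsum fun m => (hc m).measurable.ennreal_ofReal.aemeasurable]
  congr 1 with m
  rw [← integral_prod_pow, ← integral_const_mul, ofReal_integral_eq_lintegral_ofReal]
  · exact integrable_continuousMap ⟨_, hc m⟩ _
  · exact Filter.Eventually.of_forall fun z => mul_nonneg (hw m) (pow_nonneg (hτ _ _) _)

theorem momentInner_nonneg (τ : ι → C(X, ℝ)) (hτ : ∀ x y, 0 ≤ ∑ i, τ i x * τ i y) (m : ℕ)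
    (μ ν : Measure X) [IsFiniteMeasure μ] [IsFiniteMeasure ν] : 0 ≤ momentInner τ m μ ν := by
  rw [← integral_prod_pow]
  exact integral_nonneg fun z => pow_nonneg (hτ _ _) _

end Prod

/-- Words in the `τ i` span the algebra they generate, which is dense in `C(X, ℝ)` by
Stone–Weierstrass. Order 0 need not be assumed: it is the total mass, equal to 1 for both measures.
-/
theorem measure_eq_of_moment_eq {X ι : Type*} [TopologicalSpace X] [CompactSpace X] [PolishSpace X]
    [MeasurableSpace X] [BorelSpace X] [Fintype ι] (τ : ι → C(X, ℝ))
    (hsep : ∀ x y, (∀ i, τ i x = τ i y) → x = y) (μ ν : Measure X) [IsProbabilityMeasure μ]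
    [IsProbabilityMeasure ν]
    (h : ∀ (m : ℕ) (α : Fin (m + 1) → ι), moment τ α μ = moment τ α ν) : μ = ν := by
  have hword : ∀ f ∈ Submonoid.closure (Set.range τ),
      ∃ (m : ℕ) (α : Fin m → ι), f = wordProd τ α := by
    intro f hf
    obtain ⟨l, hl, rfl⟩ := Submonoid.exists_list_of_mem_closure hf
    have hl' : ∀ k : Fin l.length, ∃ i, τ i = l.get k := fun k => hl _ (List.get_mem l k)
    choose α hα using hl'
    refine ⟨l.length, α, ?_⟩
    simp only [wordProd, hα]
    rw [← List.prod_ofFn, List.ofFn_get]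
  have hmoment : ∀ (m : ℕ) (α : Fin m → ι), moment τ α μ = moment τ α ν := by
    rintro (_ | m) α
    · simp [moment, wordProd]
    · exact h m α
  have hadj : ∀ f ∈ Algebra.adjoin ℝ (Set.range τ), ∫ x, f x ∂μ = ∫ x, f x ∂ν := by
    intro f hf
    rw [← Subalgebra.mem_toSubmodule, Algebra.adjoin_eq_span] at hf
    induction hf using Submodule.span_induction with
    | mem f hf =>
      obtain ⟨m, α, rfl⟩ := hword f hf
      exact hmoment m α
    | zero => simp
    | add f g _ _ hf hg =>
      simp only [ContinuousMap.add_apply]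
      rw [integral_add (integrable_continuousMap f _) (integrable_continuousMap g _),
        integral_add (integrable_continuousMap f _) (integrable_continuousMap g _), hf, hg]
    | smul c f _ hf =>
      simp only [ContinuousMap.smul_apply, integral_smul, hf]
  have hdense : ∀ f : C(X, ℝ), f ∈ (Algebra.adjoin ℝ (Set.range τ)).topologicalClosure := by
    intro f
    rw [ContinuousMap.subalgebra_topologicalClosure_eq_top_of_separatesPoints]
    · trivial
    · intro x y hxy
      by_contra! hcon
      refine hxy (hsep x y fun i => hcon (τ i) ⟨τ i, Algebra.subset_adjoin ⟨i, rfl⟩, rfl⟩)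
  refine ext_of_forall_integral_eq_of_IsFiniteMeasure fun f => ?_
  -- Integration is 1-Lipschitz for the sup norm, so equality of integrals passes to the closure of
  -- the algebra.
  have hcont : ∀ ρ : Measure X, IsProbabilityMeasure ρ →
      Continuous fun f : C(X, ℝ) => ∫ x, f x ∂ρ := by
    intro ρ _
    refine (LipschitzWith.of_dist_le_mul (K := 1) fun f g => ?_).continuous
    rw [NNReal.coe_one, one_mul, dist_eq_norm, dist_eq_norm,
      ← integral_sub (integrable_continuousMap f _) (integrable_continuousMap g _)]
    refine (norm_integral_le_of_norm_le_const
      (Filter.Eventually.of_forall fun x => (f - g).norm_coe_le_norm x)).trans_eq ?_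
    simp
  have hclosed := isClosed_eq (hcont μ inferInstance) (hcont ν inferInstance)
  exact hclosed.closure_subset_iff.mpr hadj (hdense f.toContinuousMap)

/-! ### The logarithmic series and extended real arithmetic -/

theorem tsum_ofReal_ne_top_iff {f : ℕ → ℝ} (hf : ∀ m, 0 ≤ f m) :
    ∑' m, ENNReal.ofReal (f m) ≠ ⊤ ↔ Summable f := by
  refine ⟨fun h => ?_, fun h => h.tsum_ofReal_ne_top⟩
  simpa [ENNReal.toReal_ofReal (hf _)] using ENNReal.summable_toReal h

theorem coe_tsum_ofReal {f : ℕ → ℝ} (hf : ∀ m, 0 ≤ f m) (hs : Summable f) :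
    ((∑' m, ENNReal.ofReal (f m) : ℝ≥0∞) : EReal) = ((∑' m, f m : ℝ) : EReal) := by
  rw [← ENNReal.ofReal_tsum_of_nonneg hf hs, EReal.coe_ennreal_ofReal,
    max_eq_left (tsum_nonneg hf)]

theorem coe_finsetSum {ι : Type*} (s : Finset ι) (f : ι → ℝ) :
    ((∑ i ∈ s, f i : ℝ) : EReal) = ∑ i ∈ s, (f i : EReal) :=
  map_sum (⟨⟨Real.toEReal, EReal.coe_zero⟩, EReal.coe_add⟩ : ℝ →+ EReal) f s

/-- The coefficients of the power series of `-log (1 - x) / 2`, shifted by one. -/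
noncomputable def logCoeff (m : ℕ) : ℝ := 1 / (2 * (m + 1))

theorem logCoeff_pos (m : ℕ) : 0 < logCoeff m := by
  unfold logCoeff
  positivity

theorem hasSum_logCoeff {p : ℝ} (h0 : 0 ≤ p) (h1 : p < 1) :
    HasSum (fun m => logCoeff m * p ^ (m + 1)) (-Real.log (1 - p) / 2) := by
  have h := (Real.hasSum_pow_div_log_of_abs_lt_one (abs_lt.mpr ⟨by linarith, h1⟩)).div_const 2
  refine h.congr_fun fun m => ?_
  unfold logCoeff
  field_simp

theorem not_summable_logCoeff : ¬ Summable logCoeff := by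
  intro h
  refine Real.not_summable_one_div_natCast ((summable_nat_add_iff 1).mp ?_)
  refine (h.mul_left 2).congr fun m => ?_
  unfold logCoeff
  push_cast
  field_simp

/-- Any splitting `f - g` of the kernel with `∫⁻ g` finite may replace the positive and negative
parts, because `(f - g) + g = f + (g - f)` holds pointwise for truncated subtraction. -/
theorem mutualEnergy_eq_sub {X : Type*} [PseudoMetricSpace X] [MeasurableSpace X]
    {f g : X × X → ℝ≥0∞} (hf : Measurable f) (hg : Measurable g) (hg_top : ∀ z, g z ≠ ⊤)
    (hk : ∀ z : X × X, logKernel z.1 z.2 = (f z : EReal) - (g z : EReal)) (μ ν : Measure X)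
    (hgi : ∫⁻ z, g z ∂(μ.prod ν) ≠ ⊤) :
    mutualEnergy μ ν
      = ((∫⁻ z, f z ∂(μ.prod ν) : ℝ≥0∞) : EReal) - ((∫⁻ z, g z ∂(μ.prod ν) : ℝ≥0∞) : EReal) := by
  have hpos : ∀ z : X × X, (logKernel z.1 z.2).toENNReal = f z - g z := fun z => by
    rw [hk, EReal.toENNReal_sub (EReal.coe_ennreal_nonneg _), EReal.toENNReal_coe,
      EReal.toENNReal_coe]
  have hneg : ∀ z : X × X, (-logKernel z.1 z.2).toENNReal = g z - f z := fun z => by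
    rw [hk, EReal.neg_sub (Or.inl (EReal.coe_ennreal_ne_bot _))
      (Or.inr (by simpa using hg_top z)), add_comm, ← sub_eq_add_neg,
      EReal.toENNReal_sub (EReal.coe_ennreal_nonneg _), EReal.toENNReal_coe,
      EReal.toENNReal_coe]
  have hadd : (∫⁻ z, (f z - g z) ∂(μ.prod ν)) + ∫⁻ z, g z ∂(μ.prod ν)
      = (∫⁻ z, f z ∂(μ.prod ν)) + ∫⁻ z, (g z - f z) ∂(μ.prod ν) := by
    rw [← lintegral_add_right _ hg, ← lintegral_add_left hf]
    refine lintegral_congr fun z => ?_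
    rw [tsub_add_eq_max, add_comm, tsub_add_eq_max, max_comm]
  have hle : ∫⁻ z, (g z - f z) ∂(μ.prod ν) ≠ ⊤ :=
    ne_top_of_le_ne_top hgi (lintegral_mono fun z => tsub_le_self)
  simp only [mutualEnergy, hpos, hneg]
  generalize (∫⁻ z, (f z - g z) ∂(μ.prod ν)) = A at *
  generalize (∫⁻ z, (g z - f z) ∂(μ.prod ν)) = N at *
  generalize (∫⁻ z, f z ∂(μ.prod ν)) = F at *
  generalize (∫⁻ z, g z ∂(μ.prod ν)) = G at *
  lift N to ℝ≥0 using hle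
  lift G to ℝ≥0 using hgi
  by_cases hA : A = ⊤
  · obtain rfl : F = ⊤ := by
      rw [hA, top_add, eq_comm, ENNReal.add_eq_top] at hadd
      simpa using hadd
    rw [hA]
    rfl
  · have hF : F ≠ ⊤ := by
      rintro rfl
      rw [top_add] at hadd
      exact ENNReal.add_ne_top.mpr ⟨hA, ENNReal.coe_ne_top⟩ hadd
    lift A to ℝ≥0 using hA
    lift F to ℝ≥0 using hF
    have h : (A : ℝ) + G = F + N := by exact_mod_cast hadd
    change ((A : ℝ) : EReal) - ((N : ℝ) : EReal) = ((F : ℝ) : EReal) - ((G : ℝ) : EReal)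
    rw [← EReal.coe_sub, ← EReal.coe_sub]
    congr 1
    linarith

/-! ### Energy as a series of moment products -/

/-- The functions `τ i` and `b` represent the distance through
`dist x y ^ 2 = exp (2 * (b x + b y)) * (1 - ⟪τ x, τ y⟫)`, so that `log (1 / dist x y)` is
a power series in `⟪τ x, τ y⟫` with positive coefficients up to the term `b x + b y`. -/
structure IsLogFeature {X ι : Type*} [MetricSpace X] [Fintype ι] (τ : ι → C(X, ℝ))
    (b : C(X, ℝ)) : Prop where
  inner_nonneg : ∀ x y, 0 ≤ ∑ i, τ i x * τ i y
  nonneg : ∀ x, 0 ≤ b x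
  dist_sq : ∀ x y, dist x y ^ 2 = Real.exp (2 * (b x + b y)) * (1 - ∑ i, τ i x * τ i y)

namespace IsLogFeature

section Kernel

variable {X ι : Type*} [MetricSpace X] [Fintype ι] {τ : ι → C(X, ℝ)} {b : C(X, ℝ)}

theorem inner_self (h : IsLogFeature τ b) (x : X) : ∑ i, τ i x * τ i x = 1 := by
  have := h.dist_sq x x
  simp only [dist_self, ne_eq, OfNat.ofNat_ne_zero, not_false_eq_true, zero_pow, zero_eq_mul,
    Real.exp_ne_zero, false_or] at this
  linarith

theorem eq_of_forall_eq (h : IsLogFeature τ b) {x y : X} (hxy : ∀ i, τ i x = τ i y) : x = y := by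
  have := h.dist_sq x y
  simp only [← hxy, h.inner_self, sub_self, mul_zero] at this
  exact dist_eq_zero.mp (pow_eq_zero_iff two_ne_zero |>.mp this)

theorem inner_lt_one (h : IsLogFeature τ b) {x y : X} (hxy : x ≠ y) :
    ∑ i, τ i x * τ i y < 1 := by
  have h1 : 0 < dist x y ^ 2 := pow_pos (dist_pos.mpr hxy) 2
  rw [h.dist_sq] at h1
  linarith [(pos_iff_pos_of_mul_pos h1).mp (Real.exp_pos _)]

theorem logKernel_eq (h : IsLogFeature τ b) (x y : X) :
    logKernel x y = ((∑' m, ENNReal.ofReal (logCoeff m * (∑ i, τ i x * τ i y) ^ (m + 1)) : ℝ≥0∞) :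
      EReal) - ((ENNReal.ofReal (b x + b y) : ℝ≥0∞) : EReal) := by
  have hb : 0 ≤ b x + b y := add_nonneg (h.nonneg x) (h.nonneg y)
  rw [EReal.coe_ennreal_ofReal, max_eq_left hb]
  by_cases hxy : x = y
  · subst hxy
    -- On the diagonal the inner product is 1, and the divergent harmonic series supplies the value
    -- `⊤`.
    have ht : ∑' m, ENNReal.ofReal (logCoeff m) = ⊤ := by
      by_contra hne
      exact not_summable_logCoeff ((tsum_ofReal_ne_top_iff fun m => (logCoeff_pos m).le).mp hne)
    simp only [logKernel_self, h.inner_self, one_pow, mul_one, ht]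
    rfl
  · have hp := h.inner_lt_one hxy
    have hs := hasSum_logCoeff (h.inner_nonneg x y) hp
    rw [coe_tsum_ofReal (fun m => mul_nonneg (logCoeff_pos m).le (pow_nonneg (h.inner_nonneg x y) _))
      hs.summable, hs.tsum_eq, ← EReal.coe_sub, logKernel_of_dist_pos (dist_pos.mpr hxy)]
    congr 1
    have hl := congrArg Real.log (h.dist_sq x y)
    rw [Real.log_pow, Real.log_mul (Real.exp_ne_zero _) (by linarith), Real.log_exp] at hl
    rw [one_div, Real.log_inv]
    push_cast at hl
    linarith

end Kernel

section Energy

variable {X ι : Type*} [MetricSpace X] [CompactSpace X] [MeasurableSpace X] [BorelSpace X]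
  [Fintype ι] {τ : ι → C(X, ℝ)} {b : C(X, ℝ)}

theorem mutualEnergy_eq (h : IsLogFeature τ b) (μ ν : Measure X) [IsProbabilityMeasure μ]
    [IsProbabilityMeasure ν] :
    mutualEnergy μ ν
      = ((∑' m, ENNReal.ofReal (logCoeff m * momentInner τ (m + 1) μ ν) : ℝ≥0∞) : EReal)
        - ((∫ x, b x ∂μ + ∫ x, b x ∂ν : ℝ) : EReal) := by
  have hbc : Continuous fun z : X × X => b z.1 + b z.2 := by fun_prop
  have hb0 : ∀ z : X × X, 0 ≤ b z.1 + b z.2 := fun z => add_nonneg (h.nonneg _) (h.nonneg _)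
  have hb : ∫⁻ z, ENNReal.ofReal (b z.1 + b z.2) ∂(μ.prod ν)
      = ENNReal.ofReal (∫ x, b x ∂μ + ∫ x, b x ∂ν) := by
    have hbi : Integrable (fun z : X × X => b z.1 + b z.2) (μ.prod ν) :=
      integrable_continuousMap ⟨_, hbc⟩ _
    rw [← ofReal_integral_eq_lintegral_ofReal hbi
      (Filter.Eventually.of_forall hb0), integral_add
        ((integrable_continuousMap b μ).comp_fst ν) ((integrable_continuousMap b ν).comp_snd μ),
      integral_fun_fst, integral_fun_snd]
    simp
  rw [mutualEnergy_eq_sub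
    (f := fun z => ∑' m, ENNReal.ofReal (logCoeff m * (∑ i, τ i z.1 * τ i z.2) ^ (m + 1)))
    (g := fun z => ENNReal.ofReal (b z.1 + b z.2)) _ hbc.measurable.ennreal_ofReal
    (fun _ => ENNReal.ofReal_ne_top) (fun z => h.logKernel_eq z.1 z.2) μ ν
    (by rw [hb]; exact ENNReal.ofReal_ne_top), hb,
    lintegral_prod_tsum_pow τ h.inner_nonneg (fun m => (logCoeff_pos m).le),
    EReal.coe_ennreal_ofReal, max_eq_left
      (add_nonneg (integral_nonneg h.nonneg) (integral_nonneg h.nonneg))]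
  refine Measurable.tsum fun m => Measurable.ennreal_ofReal (Continuous.measurable ?_)
  fun_prop

theorem mul_momentInner_nonneg (h : IsLogFeature τ b) (m : ℕ) (μ ν : Measure X)
    [IsFiniteMeasure μ] [IsFiniteMeasure ν] :
    0 ≤ logCoeff m * momentInner τ (m + 1) μ ν :=
  mul_nonneg (logCoeff_pos m).le (momentInner_nonneg τ h.inner_nonneg _ _ _)

theorem energy_lt_top_iff (h : IsLogFeature τ b) (μ : Measure X) [IsProbabilityMeasure μ] :
    energy μ < ⊤ ↔ Summable fun m => logCoeff m * momentInner τ (m + 1) μ μ := by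
  rw [energy, h.mutualEnergy_eq,
    ← tsum_ofReal_ne_top_iff fun m => h.mul_momentInner_nonneg m μ μ, lt_top_iff_ne_top]
  refine not_congr ⟨fun ht => ?_, fun ht => by rw [ht]; rfl⟩
  by_contra hne
  rw [← EReal.coe_ennreal_toReal hne, ← EReal.coe_sub] at ht
  exact EReal.coe_ne_top _ ht

/-- Finite self-energies force a finite mutual energy, by `2xy ≤ x² + y²` on each moment. -/
theorem summable_momentInner (h : IsLogFeature τ b) (μ ν : Measure X) [IsFiniteMeasure μ]
    [IsFiniteMeasure ν] (hμ : Summable fun m => logCoeff m * momentInner τ (m + 1) μ μ)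
    (hν : Summable fun m => logCoeff m * momentInner τ (m + 1) ν ν) :
    Summable fun m => logCoeff m * momentInner τ (m + 1) μ ν := by
  refine Summable.of_nonneg_of_le (fun m => h.mul_momentInner_nonneg m μ ν) (fun m => ?_)
    (hμ.add hν)
  nlinarith [two_mul_momentInner_le τ (m + 1) μ ν, h.mul_momentInner_nonneg m μ ν, logCoeff_pos m]

end Energy

end IsLogFeature

/-! ### Expansion, semicontinuity and strict convexity of `J₀` -/

section MomentForm

variable {X ι : Type*} [TopologicalSpace X] [Fintype ι] [MeasurableSpace X] {d : ℕ}

/-- The quadratic form of `C` at the moments of order `m` of a tuple of measures. -/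
noncomputable def momentForm (τ : ι → C(X, ℝ)) (C : Matrix (Fin d) (Fin d) ℝ) (m : ℕ)
    (μ : Fin d → Measure X) : ℝ :=
  ∑ α : Fin m → ι, quadForm C fun i => moment τ α (μ i)

theorem momentForm_eq_sum (τ : ι → C(X, ℝ)) (C : Matrix (Fin d) (Fin d) ℝ) (m : ℕ)
    (μ : Fin d → Measure X) :
    momentForm τ C m μ = ∑ i, ∑ j, C i j * momentInner τ m (μ i) (μ j) := by
  simp only [momentForm, quadForm, momentInner, Finset.mul_sum]
  rw [Finset.sum_comm]
  exact Finset.sum_congr rfl fun i _ => Finset.sum_comm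

theorem momentForm_nonneg (τ : ι → C(X, ℝ)) {C : Matrix (Fin d) (Fin d) ℝ} (hC : C.PosDef) (m : ℕ)
    (μ : Fin d → Measure X) : 0 ≤ momentForm τ C m μ :=
  Finset.sum_nonneg fun _ _ => quadForm_nonneg hC _

/-- The affine part of `J₀`. -/
noncomputable def potentialForm (b : C(X, ℝ)) (C : Matrix (Fin d) (Fin d) ℝ)
    (μ : Fin d → Measure X) : ℝ :=
  ∑ i, ∑ j, C i j * (∫ x, b x ∂(μ i) + ∫ x, b x ∂(μ j))

end MomentForm

namespace IsLogFeature

variable {X ι : Type*} [MetricSpace X] [CompactSpace X] [MeasurableSpace X] [BorelSpace X]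
  [Fintype ι] {τ : ι → C(X, ℝ)} {b : C(X, ℝ)} {d : ℕ} {C : Matrix (Fin d) (Fin d) ℝ}

theorem J₀_eq (h : IsLogFeature τ b) (hC : C.PosDef) (μ : Fin d → Measure X)
    (hμ : ∀ i, IsProbabilityMeasure (μ i)) :
    J₀ C μ = ((∑' m, ENNReal.ofReal (logCoeff m * momentForm τ C (m + 1) μ) : ℝ≥0∞) : EReal)
      - (potentialForm b C μ : EReal) := by
  have hnn : ∀ m, 0 ≤ logCoeff m * momentForm τ C (m + 1) μ := fun m =>
    mul_nonneg (logCoeff_pos m).le (momentForm_nonneg τ hC _ μ)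
  by_cases hfin : ∀ i, energy (μ i) < ⊤
  · have hsum : ∀ i j, Summable fun m => logCoeff m * momentInner τ (m + 1) (μ i) (μ j) :=
      fun i j => h.summable_momentInner _ _ ((h.energy_lt_top_iff _).mp (hfin i))
        ((h.energy_lt_top_iff _).mp (hfin j))
    have hform : HasSum (fun m => logCoeff m * momentForm τ C (m + 1) μ)
        (∑ i, ∑ j, C i j * ∑' m, logCoeff m * momentInner τ (m + 1) (μ i) (μ j)) := by
      refine (hasSum_sum fun i _ => hasSum_sum fun j _ =>
        (hsum i j).hasSum.mul_left (C i j)).congr_fun fun m => ?_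
      simp only [momentForm_eq_sum, Finset.mul_sum]
      exact Finset.sum_congr rfl fun i _ => Finset.sum_congr rfl fun j _ => by ring
    rw [J₀, if_pos hfin, coe_tsum_ofReal hnn hform.summable, hform.tsum_eq, ← EReal.coe_sub]
    have hterm : ∀ i j, (C i j : EReal) * mutualEnergy (μ i) (μ j)
        = ((C i j * (∑' m, logCoeff m * momentInner τ (m + 1) (μ i) (μ j)
          - (∫ x, b x ∂(μ i) + ∫ x, b x ∂(μ j))) : ℝ) : EReal) := by
      intro i j
      rw [h.mutualEnergy_eq, coe_tsum_ofReal (fun m => h.mul_momentInner_nonneg m _ _) (hsum i j),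
        ← EReal.coe_sub, ← EReal.coe_mul]
    simp only [hterm]
    rw [potentialForm, ← Finset.sum_sub_distrib]
    simp only [← Finset.sum_sub_distrib, ← mul_sub]
    simp only [coe_finsetSum]
  · rw [J₀, if_neg hfin]
    push Not at hfin
    obtain ⟨i, hi⟩ := hfin
    -- Coercivity bounds the energy series of `μ i` by `r⁻¹` times this series, so an infinite
    -- energy makes it diverge: the convention `J₀ = ⊤` agrees with the formula.
    have htop : ∑' m, ENNReal.ofReal (logCoeff m * momentForm τ C (m + 1) μ) = ⊤ := by
      by_contra hne
      rw [← ne_eq, tsum_ofReal_ne_top_iff hnn] at hne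
      obtain ⟨r, hr, hle⟩ := exists_pos_mul_sq_le_quadForm hC
      refine not_lt.mpr hi ((h.energy_lt_top_iff (μ i)).mpr ?_)
      refine Summable.of_nonneg_of_le (fun m => h.mul_momentInner_nonneg m _ _) (fun m => ?_)
        (hne.mul_left r⁻¹)
      have hm : r * momentInner τ (m + 1) (μ i) (μ i) ≤ momentForm τ C (m + 1) μ := by
        rw [momentInner, Finset.mul_sum]
        refine Finset.sum_le_sum fun α _ => ?_
        rw [← sq]
        exact hle (fun i => moment τ α (μ i)) i
      rw [← mul_assoc, mul_comm r⁻¹, mul_assoc]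
      exact mul_le_mul_of_nonneg_left ((le_inv_mul_iff₀ hr).mpr hm) (logCoeff_pos m).le
    rw [htop]
    rfl

theorem J₀_ne_bot (h : IsLogFeature τ b) (hC : C.PosDef) (μ : Fin d → Measure X)
    (hμ : ∀ i, IsProbabilityMeasure (μ i)) : J₀ C μ ≠ ⊥ := by
  rw [h.J₀_eq hC μ hμ, sub_eq_add_neg, ← EReal.coe_neg, ne_eq, EReal.add_eq_bot_iff]
  simp

theorem J₀_ne_top_iff (h : IsLogFeature τ b) (hC : C.PosDef) (μ : Fin d → Measure X)
    (hμ : ∀ i, IsProbabilityMeasure (μ i)) :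
    J₀ C μ ≠ ⊤ ↔ Summable fun m => logCoeff m * momentForm τ C (m + 1) μ := by
  have hnn : ∀ m, 0 ≤ logCoeff m * momentForm τ C (m + 1) μ := fun m =>
    mul_nonneg (logCoeff_pos m).le (momentForm_nonneg τ hC _ μ)
  rw [h.J₀_eq hC μ hμ, ← tsum_ofReal_ne_top_iff hnn]
  refine not_congr ⟨fun ht => ?_, fun ht => by rw [ht]; rfl⟩
  by_contra hne
  rw [← EReal.coe_ennreal_toReal hne, ← EReal.coe_sub] at ht
  exact EReal.coe_ne_top _ ht

theorem toReal_J₀ (h : IsLogFeature τ b) (hC : C.PosDef) (μ : Fin d → Measure X)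
    (hμ : ∀ i, IsProbabilityMeasure (μ i))
    (hs : Summable fun m => logCoeff m * momentForm τ C (m + 1) μ) :
    (J₀ C μ).toReal = ∑' m, logCoeff m * momentForm τ C (m + 1) μ - potentialForm b C μ := by
  rw [h.J₀_eq hC μ hμ, coe_tsum_ofReal (fun m =>
    mul_nonneg (logCoeff_pos m).le (momentForm_nonneg τ hC _ μ)) hs, ← EReal.coe_sub,
    EReal.toReal_coe]

theorem lowerSemicontinuous_J₀ (h : IsLogFeature τ b) (hC : C.PosDef) :
    LowerSemicontinuous fun μ : Fin d → ProbabilityMeasure X =>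
      J₀ C fun i => (μ i : Measure X) := by
  have hint : ∀ (f : C(X, ℝ)) (i : Fin d), Continuous fun μ : Fin d → ProbabilityMeasure X =>
      ∫ x, f x ∂(μ i : Measure X) := fun f i =>
    (continuous_integral_continuousMap f).comp (continuous_apply i)
  have hpot : Continuous fun μ : Fin d → ProbabilityMeasure X =>
      potentialForm b C fun i => (μ i : Measure X) := by
    unfold potentialForm
    exact continuous_finsetSum _ fun i _ => continuous_finsetSum _ fun j _ =>
      continuous_const.mul ((hint b i).add (hint b j))
  have hform : ∀ m, Continuous fun μ : Fin d → ProbabilityMeasure X =>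
      momentForm τ C m fun i => (μ i : Measure X) := by
    intro m
    unfold momentForm moment
    exact continuous_finsetSum _ fun α _ => (continuous_quadForm C).comp
      (continuous_pi fun i => hint (wordProd τ α) i)
  have htsum : LowerSemicontinuous fun μ : Fin d → ProbabilityMeasure X =>
      ((∑' m, ENNReal.ofReal (logCoeff m * momentForm τ C (m + 1) fun i => (μ i : Measure X)) :
        ℝ≥0∞) : EReal) :=
    continuous_coe_ennreal_ereal.comp_lowerSemicontinuous
      (lowerSemicontinuous_tsum fun m => (ENNReal.continuous_ofReal.comp
        (continuous_const.mul (hform (m + 1)))).lowerSemicontinuous)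
      EReal.coe_ennreal_strictMono.monotone
  -- Addition in `EReal` is continuous here because the second summand is always real.
  have hsum := htsum.add' (continuous_coe_real_ereal.comp hpot.neg).lowerSemicontinuous
    fun μ => EReal.continuousAt_add (Or.inr (EReal.coe_ne_bot _)) (Or.inr (EReal.coe_ne_top _))
  have heq : (fun μ : Fin d → ProbabilityMeasure X => J₀ C fun i => (μ i : Measure X)) = _ :=
    funext fun μ => (h.J₀_eq hC _ fun i => inferInstance).trans (sub_eq_add_neg _ _)
  rw [heq]
  exact hsum

theorem potentialForm_convexComb (b : C(X, ℝ)) (C : Matrix (Fin d) (Fin d) ℝ)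
    (μ ν : Fin d → Measure X) [∀ i, IsFiniteMeasure (μ i)] [∀ i, IsFiniteMeasure (ν i)]
    (s t : ℝ≥0) :
    potentialForm b C (s • μ + t • ν) = s * potentialForm b C μ + t * potentialForm b C ν := by
  simp only [potentialForm, Pi.add_apply, Pi.smul_apply, integral_smul_add_smul, Finset.mul_sum,
    ← Finset.sum_add_distrib]
  exact Finset.sum_congr rfl fun i _ => Finset.sum_congr rfl fun j _ => by ring

theorem momentForm_convexComb (τ : ι → C(X, ℝ)) (C : Matrix (Fin d) (Fin d) ℝ) (m : ℕ)
    (μ ν : Fin d → Measure X) [∀ i, IsFiniteMeasure (μ i)] [∀ i, IsFiniteMeasure (ν i)]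
    {s t : ℝ≥0} (hst : s + t = 1) :
    momentForm τ C m (s • μ + t • ν)
        + s * t * ∑ α : Fin m → ι, quadForm C (fun i => moment τ α (μ i) - moment τ α (ν i))
      = s * momentForm τ C m μ + t * momentForm τ C m ν := by
  have hst' : (s : ℝ) + t = 1 := by exact_mod_cast hst
  simp only [momentForm, Finset.mul_sum, ← Finset.sum_add_distrib]
  refine Finset.sum_congr rfl fun α _ => ?_
  rw [← quadForm_convexComb C hst']
  simp only [moment, Pi.add_apply, Pi.smul_apply, integral_smul_add_smul]
  rfl

theorem strictConvexOn_J₀ (h : IsLogFeature τ b) (hC : C.PosDef) :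
    StrictConvexOn ℝ≥0
      {μ : Fin d → Measure X | (∀ i, IsProbabilityMeasure (μ i)) ∧ J₀ C μ ≠ ⊤}
      (fun μ => (J₀ C μ).toReal) := by
  have hprob : ∀ (μ ν : Fin d → Measure X), (∀ i, IsProbabilityMeasure (μ i)) →
      (∀ i, IsProbabilityMeasure (ν i)) → ∀ s t : ℝ≥0, s + t = 1 →
      ∀ i, IsProbabilityMeasure ((s • μ + t • ν) i) := by
    intro μ ν hμ hν s t hst i
    refine ⟨?_⟩
    have : (s : ℝ≥0∞) + t = 1 := by exact_mod_cast hst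
    rw [Pi.add_apply, Pi.smul_apply, Pi.smul_apply, Measure.add_apply, Measure.smul_apply,
      Measure.smul_apply, (hμ i).measure_univ, (hν i).measure_univ, ENNReal.smul_def,
      ENNReal.smul_def, smul_eq_mul, smul_eq_mul, mul_one, mul_one, this]
  have hnn : ∀ μ m, 0 ≤ logCoeff m * momentForm τ C (m + 1) μ := fun μ m =>
    mul_nonneg (logCoeff_pos m).le (momentForm_nonneg τ hC _ μ)
  have hdiff : ∀ (μ ν : Fin d → Measure X) (m : ℕ),
      0 ≤ ∑ α : Fin m → ι, quadForm C fun i => moment τ α (μ i) - moment τ α (ν i) :=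
    fun μ ν m => Finset.sum_nonneg fun α _ => quadForm_nonneg hC _
  have hle : ∀ (μ ν : Fin d → Measure X), (∀ i, IsProbabilityMeasure (μ i)) →
      (∀ i, IsProbabilityMeasure (ν i)) → ∀ s t : ℝ≥0, s + t = 1 → ∀ m,
      logCoeff m * momentForm τ C (m + 1) (s • μ + t • ν)
        ≤ s * (logCoeff m * momentForm τ C (m + 1) μ)
          + t * (logCoeff m * momentForm τ C (m + 1) ν) := by
    intro μ ν hμ hν s t hst m
    have h1 := momentForm_convexComb τ C (m + 1) μ ν hst
    have h2 := mul_nonneg (mul_nonneg s.coe_nonneg t.coe_nonneg) (hdiff μ ν (m + 1))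
    have h3 := mul_le_mul_of_nonneg_left (show momentForm τ C (m + 1) (s • μ + t • ν) ≤
      s * momentForm τ C (m + 1) μ + t * momentForm τ C (m + 1) ν by linarith) (logCoeff_pos m).le
    linarith
  have hsummable : ∀ (μ ν : Fin d → Measure X), (∀ i, IsProbabilityMeasure (μ i)) →
      (∀ i, IsProbabilityMeasure (ν i)) → ∀ s t : ℝ≥0, s + t = 1 →
      (Summable fun m => logCoeff m * momentForm τ C (m + 1) μ) →
      (Summable fun m => logCoeff m * momentForm τ C (m + 1) ν) →
      Summable fun m => logCoeff m * momentForm τ C (m + 1) (s • μ + t • ν) :=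
    fun μ ν hμ hν s t hst h1 h2 => Summable.of_nonneg_of_le (hnn _)
      (hle μ ν hμ hν s t hst) ((h1.mul_left _).add (h2.mul_left _))
  refine ⟨?_, ?_⟩
  · rintro μ ⟨hμ, hμt⟩ ν ⟨hν, hνt⟩ s t - - hst
    have hp := hprob μ ν hμ hν s t hst
    rw [h.J₀_ne_top_iff hC _ ‹_›] at hμt hνt
    exact ⟨hp, (h.J₀_ne_top_iff hC _ hp).mpr (hsummable μ ν hμ hν s t hst hμt hνt)⟩
  · rintro μ ⟨hμ, hμt⟩ ν ⟨hν, hνt⟩ hne s t hs ht hst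
    have hp := hprob μ ν hμ hν s t hst
    rw [h.J₀_ne_top_iff hC _ ‹_›] at hμt hνt
    have hsum := hsummable μ ν hμ hν s t hst hμt hνt
    -- Distinct tuples differ in some moment of positive order; the defect of that one term is
    -- positive, which suffices for a strict inequality between the sums.
    obtain ⟨m, α, i, hα⟩ : ∃ (m : ℕ) (α : Fin (m + 1) → ι) (i : Fin d),
        moment τ α (μ i) ≠ moment τ α (ν i) := by
      by_contra! hcon
      exact hne (funext fun i => measure_eq_of_moment_eq τ (fun x y => h.eq_of_forall_eq) _ _
        fun m α => hcon m α i)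
    have hlt : logCoeff m * momentForm τ C (m + 1) (s • μ + t • ν)
        < s * (logCoeff m * momentForm τ C (m + 1) μ)
          + t * (logCoeff m * momentForm τ C (m + 1) ν) := by
      have h1 := momentForm_convexComb τ C (m + 1) μ ν hst
      have h2 : 0 < ∑ β : Fin (m + 1) → ι, quadForm C fun i =>
          moment τ β (μ i) - moment τ β (ν i) :=
        Finset.sum_pos' (fun β _ => quadForm_nonneg hC _)
          ⟨α, Finset.mem_univ _, quadForm_pos hC fun h0 => hα (sub_eq_zero.mp (congrFun h0 i))⟩
      have h3 := mul_pos (mul_pos (NNReal.coe_pos.mpr hs) (NNReal.coe_pos.mpr ht)) h2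
      have h4 := mul_lt_mul_of_pos_left (show momentForm τ C (m + 1) (s • μ + t • ν) <
        s * momentForm τ C (m + 1) μ + t * momentForm τ C (m + 1) ν by linarith) (logCoeff_pos m)
      linarith
    have htsum := Summable.tsum_lt_tsum (hle μ ν hμ hν s t hst) hlt hsum
      ((hμt.mul_left _).add (hνt.mul_left _))
    rw [(hμt.mul_left _).tsum_add (hνt.mul_left _), tsum_mul_left, tsum_mul_left] at htsum
    simp only [NNReal.smul_def, smul_eq_mul]
    change (J₀ C (s • μ + t • ν)).toReal < _
    rw [h.toReal_J₀ hC μ hμ hμt, h.toReal_J₀ hC ν hν hνt, h.toReal_J₀ hC _ hp hsum,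
      potentialForm_convexComb]
    linarith

end IsLogFeature

/-! ### The stereographic embedding of Euclidean space -/

section Euclidean

variable {n : ℕ} (K : Set (EuclideanSpace ℝ (Fin n)))

/-- The vector `(1, ‖x‖ ^ 2, √2 x) / (1 + ‖x‖ ^ 2)`, which lies on the unit sphere. -/
noncomputable def sphereFeature : Option (Option (Fin n)) → C(K, ℝ)
  | none => ⟨fun x => 1 / (1 + ‖(x : EuclideanSpace ℝ (Fin n))‖ ^ 2),
      continuous_const.div (by fun_prop) fun x => by positivity⟩
  | some none => ⟨fun x => ‖(x : EuclideanSpace ℝ (Fin n))‖ ^ 2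
      / (1 + ‖(x : EuclideanSpace ℝ (Fin n))‖ ^ 2),
      Continuous.div (by fun_prop) (by fun_prop) fun x => by positivity⟩
  | some (some i) => ⟨fun x => √2 * (x : EuclideanSpace ℝ (Fin n)) i
      / (1 + ‖(x : EuclideanSpace ℝ (Fin n))‖ ^ 2),
      Continuous.div (by fun_prop) (by fun_prop) fun x => by positivity⟩

/-- The function `log (1 + ‖x‖ ^ 2) / 2`. -/
noncomputable def halfLogOneAddNormSq : C(K, ℝ) :=
  ⟨fun x => Real.log (1 + ‖(x : EuclideanSpace ℝ (Fin n))‖ ^ 2) / 2,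
    (Continuous.log (by fun_prop) fun x => by positivity).div_const 2⟩

theorem sum_sphereFeature_mul (x y : K) :
    ∑ i, sphereFeature K i x * sphereFeature K i y
      = (1 + ‖(x : EuclideanSpace ℝ (Fin n))‖ ^ 2 * ‖(y : EuclideanSpace ℝ (Fin n))‖ ^ 2
          + 2 * inner ℝ (x : EuclideanSpace ℝ (Fin n)) y)
        / ((1 + ‖(x : EuclideanSpace ℝ (Fin n))‖ ^ 2)
          * (1 + ‖(y : EuclideanSpace ℝ (Fin n))‖ ^ 2)) := by
  have h2 : √(2 : ℝ) * √2 = 2 := Real.mul_self_sqrt (by norm_num)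
  have hterm : ∀ i : Fin n, √2 * (x : EuclideanSpace ℝ (Fin n)) i
        / (1 + ‖(x : EuclideanSpace ℝ (Fin n))‖ ^ 2)
        * (√2 * (y : EuclideanSpace ℝ (Fin n)) i / (1 + ‖(y : EuclideanSpace ℝ (Fin n))‖ ^ 2))
      = 2 / ((1 + ‖(x : EuclideanSpace ℝ (Fin n))‖ ^ 2)
          * (1 + ‖(y : EuclideanSpace ℝ (Fin n))‖ ^ 2))
        * ((y : EuclideanSpace ℝ (Fin n)) i * (x : EuclideanSpace ℝ (Fin n)) i) := by
    intro i
    rw [div_mul_div_comm, div_mul_eq_mul_div]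
    congr 1
    linear_combination (x : EuclideanSpace ℝ (Fin n)) i * (y : EuclideanSpace ℝ (Fin n)) i * h2
  simp only [Fintype.sum_option, sphereFeature, ContinuousMap.coe_mk, hterm, ← Finset.mul_sum,
    PiLp.inner_apply, RCLike.inner_apply, conj_trivial]
  field_simp
  ring

theorem isLogFeature_sphereFeature :
    IsLogFeature (sphereFeature K) (halfLogOneAddNormSq K) where
  inner_nonneg x y := by
    rw [sum_sphereFeature_mul]
    refine div_nonneg ?_ (by positivity)
    -- By Cauchy–Schwarz the numerator is at least `(1 - ‖x‖ * ‖y‖) ^ 2`.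
    nlinarith [neg_le_of_abs_le (abs_real_inner_le_norm (x : EuclideanSpace ℝ (Fin n)) y),
      sq_nonneg (1 - ‖(x : EuclideanSpace ℝ (Fin n))‖ * ‖(y : EuclideanSpace ℝ (Fin n))‖)]
  nonneg x := by
    refine div_nonneg (Real.log_nonneg ?_) two_pos.le
    linarith [sq_nonneg ‖(x : EuclideanSpace ℝ (Fin n))‖]
  dist_sq x y := by
    have hexp : Real.exp (2 * (halfLogOneAddNormSq K x + halfLogOneAddNormSq K y))
        = (1 + ‖(x : EuclideanSpace ℝ (Fin n))‖ ^ 2)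
          * (1 + ‖(y : EuclideanSpace ℝ (Fin n))‖ ^ 2) := by
      simp only [halfLogOneAddNormSq, ContinuousMap.coe_mk]
      rw [← add_div, mul_div_cancel₀ _ two_ne_zero, Real.exp_add, Real.exp_log (by positivity),
        Real.exp_log (by positivity)]
    rw [hexp, sum_sphereFeature_mul, Subtype.dist_eq, dist_eq_norm, norm_sub_sq_real]
    field_simp
    ring

end Euclidean

end LogEnergy

/-- Here `ProbabilityMeasure K`, with its weak topology, is the space of Borel probability measures
on the compact set `K`. The first conjunct says that `J₀` takes its values in `(-∞, +∞]`, so that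
`toReal` in the last one is its true value on the set where it is finite. Convex combinations of
measures are taken with coefficients in `ℝ≥0`. -/
theorem theorem2 (n d : ℕ) (K : Set (EuclideanSpace ℝ (Fin n))) (hK : IsCompact K)
    (hcap : LogEnergy.HasPositiveCapacity K)
    (C : Matrix (Fin d) (Fin d) ℝ) (hC : C.PosDef) :
    (∀ μ : Fin d → ProbabilityMeasure K,
      LogEnergy.J₀ C (fun i => (μ i : Measure K)) ≠ ⊥) ∧
    LowerSemicontinuous
      (fun μ : Fin d → ProbabilityMeasure K => LogEnergy.J₀ C (fun i => (μ i : Measure K))) ∧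
    StrictConvexOn ℝ≥0
      {μ : Fin d → Measure K | (∀ i, IsProbabilityMeasure (μ i)) ∧ LogEnergy.J₀ C μ ≠ ⊤}
      (fun μ => (LogEnergy.J₀ C μ).toReal) := by
  have : CompactSpace K := isCompact_iff_compactSpace.mp hK
  have h := LogEnergy.isLogFeature_sphereFeature K
  exact ⟨fun μ => h.J₀_ne_bot hC _ fun i => inferInstance, h.lowerSemicontinuous_J₀ hC,
    h.strictConvexOn_J₀ hC⟩
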